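/- Let $\mathbb U=\{z\in\mathbb C:|z|<1\}$. For $g,h$ analytic in $\mathbb U$ write $g\prec h$ if $g=h\circ\omega$ on $\mathbb U$ for some analytic $\omega:\mathbb U\to\mathbb U$ with $\omega(0)=0$. Let $p\ge 1$ be an integer, let $\lambda,\alpha$ be real with $|\lambda|<\pi/2$ and $0\le\alpha<1$, and let $a,b$ be non-zero complex numbers. Let $\mathcal A_p$ be the class of functions $f(z)=z^p+\sum_{k\ge p+1}a_kz^k$ analytic in $\mathbb U$, and let $\mathcal S_p^\lambda(\alpha,b)$ be the class of those $f\in\mathcal A_p$ with $f(z)\ne0$ for $0<|z|<1$ and $$\operatorname{Re}\left(\frac1{b\cos\lambda}\left[e^{i\lambda}\frac{zf'(z)}{pf(z)}-(1-b)\cos\lambda-i\sin\lambda\right]\right)>\alpha\qquad(z\in\mathbb U).$$ Here $zf'(z)/(pf(z))$ and $f(z)/z^p$ are given the value $1$ at $z=0$. The power $(f(z)/z^p)^a$ means $\exp(a\log (f(z)/z^p))$ with the analytic branch of the logarithm in $\mathbb U$ that vanishes at $z=0$; powers of $1-z$ are principal. Put $c=2pab(1-\alpha)e^{-i\lambda}\cos\lambda$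 and suppose that $|c+1|\le1$ or $|c-1|\le1$. Then: (i) A function $f\in\mathcal A_p$ belongs to $\mathcal S_p^\lambda(\alpha,b)$ if and only if $$1+\frac{e^{i\lambda}}{b\cos\lambda}\left[\frac{zf'(z)}{pf(z)}-1\right]\prec\frac{1+(1-2\alpha)z}{1-z}.$$ (ii) If $f\in\mathcal S_p^\lambda(\alpha,b)$, then the power $P(z)=(f(z)/z^p)^a$ exists as an analytic function in $\mathbb U$, it satisfies the differential subordination $$1+\frac{e^{i\lambda}}{pab\cos\lambda}\,\frac{zP'(z)}{P(z)}\prec\frac{1+(1-2\alpha)z}{1-z},\qquad(*)$$ and $$\left(\frac{f(z)}{z^p}\right)^a\prec q(z):=\frac1{(1-z)^{c}}.$$ (iii) The function $q$ is the best dominant of $(*)$. That is, call an analytic, zero-free function $P$ in $\mathbb U$ with $P(0)=1$ that satisfies $(*)$ a solution, and call a function $r$ analytic in $\mathbb U$ a dominant if $P\prec r$ for every solution $P$. Then $q$ is a univalent dominant, and $q\prec r$ for every dominant $r$. -/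

import Mathlib

namespace DiskSub

/-- The open unit disk. -/
abbrev unitDisk : Set ℂ := Metric.ball (0 : ℂ) 1

/-- Subordination `g ≺ h` of functions analytic in the unit disk: `g = h ∘ ω` on the disk for some
analytic self-map `ω` of the disk with `ω 0 = 0`. -/
def Subordinate (g h : ℂ → ℂ) : Prop :=
  DifferentiableOn ℂ g unitDisk ∧ DifferentiableOn ℂ h unitDisk ∧
    ∃ ω : ℂ → ℂ, DifferentiableOn ℂ ω unitDisk ∧ Set.MapsTo ω unitDisk unitDisk ∧ ω 0 = 0 ∧
      ∀ z ∈ unitDisk, g z = h (ω z)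

/-- The class `𝒜_p` of functions `f(z) = z^p + ∑_{k ≥ p+1} a_k z^k` analytic in the unit disk. -/
def classA (p : ℕ) : Set (ℂ → ℂ) :=
  {f | DifferentiableOn ℂ f unitDisk ∧
    ∃ c : ℕ → ℂ, ∀ z ∈ unitDisk, HasSum (fun k : ℕ => c k * z ^ (p + 1 + k)) (f z - z ^ p)}

/-- The function `z f'(z) / (p f(z))`, with its removable singularity at `0` filled in
(its value there is `1` for `f` in `classA p`). -/
noncomputable def logDerivQuot (p : ℕ) (f : ℂ → ℂ) (z : ℂ) : ℂ :=
  if z = 0 then 1 else z * deriv f z / (p * f z)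

/-- The class `S_p^θ(α, b)` of multivalent `θ`-spirallike functions of complex order `b` and
type `α`. The condition that `f` has no zero except at the origin says that the quotient
`z f'(z) / (p f(z))` is defined throughout the disk. -/
def spirallike (p : ℕ) (θ α : ℝ) (b : ℂ) : Set (ℂ → ℂ) :=
  {f | f ∈ classA p ∧ (∀ z ∈ unitDisk, z ≠ 0 → f z ≠ 0) ∧
    ∀ z ∈ unitDisk,
      α < (1 / (b * (Real.cos θ : ℂ)) *
        (Complex.exp (Complex.I * θ) * logDerivQuot p f z
          - (1 - b) * (Real.cos θ : ℂ) - Complex.I * (Real.sin θ : ℂ))).re}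

/-- The function `1 + e^{iθ} / (b cos θ) * (z f'(z) / (p f(z)) - 1)`. -/
noncomputable def spiralExpr (p : ℕ) (θ : ℝ) (b : ℂ) (f : ℂ → ℂ) (z : ℂ) : ℂ :=
  1 + Complex.exp (Complex.I * θ) / (b * (Real.cos θ : ℂ)) * (logDerivQuot p f z - 1)

/-- The univalent function `(1 + (1 - 2α) z) / (1 - z)`. -/
noncomputable def halfPlaneMap (α : ℝ) (z : ℂ) : ℂ :=
  (1 + (1 - 2 * (α : ℂ)) * z) / (1 - z)

/-- The function `f(z) / z^p`, with its removable singularity at `0` filled in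
(its value there is `1` for `f` in `classA p`). -/
noncomputable def normQuot (p : ℕ) (f : ℂ → ℂ) (z : ℂ) : ℂ :=
  if z = 0 then 1 else f z / z ^ p

/-- `G` is the power `F ^ a` on the unit disk, for `F` with `F 0 = 1`: the single-valued analytic
branch `exp (a log F)`, where `log F` is the analytic logarithm of `F` in the disk which takes
the principal value `0` at the origin. -/
def IsPower (F : ℂ → ℂ) (a : ℂ) (G : ℂ → ℂ) : Prop :=
  ∃ L : ℂ → ℂ, DifferentiableOn ℂ L unitDisk ∧ L 0 = 0 ∧
    (∀ z ∈ unitDisk, Complex.exp (L z) = F z) ∧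
    ∀ z ∈ unitDisk, G z = Complex.exp (a * L z)

/-- `P` is a solution of the first-order differential subordination `ψ (P z, z P'(z); z) ≺ h z`,
among the functions analytic in the disk with values in `Ω` (where `ψ` is defined) and with the
prescribed initial value `P 0 = w₀`. -/
def IsSolution (Ω : Set ℂ) (w₀ : ℂ) (ψ : ℂ → ℂ → ℂ → ℂ) (h P : ℂ → ℂ) : Prop :=
  DifferentiableOn ℂ P unitDisk ∧ P 0 = w₀ ∧ Set.MapsTo P unitDisk Ω ∧
    Subordinate (fun z => ψ (P z) (z * deriv P z) z) h

/-- `q` is a dominant of the differential subordination. -/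
def IsDominant (Ω : Set ℂ) (w₀ : ℂ) (ψ : ℂ → ℂ → ℂ → ℂ) (h q : ℂ → ℂ) : Prop :=
  DifferentiableOn ℂ q unitDisk ∧ ∀ P : ℂ → ℂ, IsSolution Ω w₀ ψ h P → Subordinate P q

/-- `q` is the best dominant of the differential subordination: a univalent dominant that is
subordinate to every dominant. -/
def IsBestDominant (Ω : Set ℂ) (w₀ : ℂ) (ψ : ℂ → ℂ → ℂ → ℂ) (h q : ℂ → ℂ) : Prop :=
  IsDominant Ω w₀ ψ h q ∧ Set.InjOn q unitDisk ∧
    ∀ r : ℂ → ℂ, IsDominant Ω w₀ ψ h r → Subordinate q r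

/-- `ψ (r, s; z) = 1 + e^{iθ} / (p a b cos θ) * (s / r)`, defined for `r ≠ 0`. -/
noncomputable def spiralPsi (p : ℕ) (θ : ℝ) (a b : ℂ) (r s _z : ℂ) : ℂ :=
  1 + Complex.exp (Complex.I * θ) / (p * a * b * (Real.cos θ : ℂ)) * (s / r)

/-- The exponent `2 p a b (1 - α) e^{-iθ} cos θ`. -/
noncomputable def spiralExponent (p : ℕ) (θ α : ℝ) (a b : ℂ) : ℂ :=
  2 * p * a * b * (1 - (α : ℂ)) * Complex.exp (-(Complex.I * θ)) * (Real.cos θ : ℂ)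

end DiskSub

/-!
Put `c = spiralExponent p θ α a b` and `q z = (1 - z) ^ (-c)`.

A zero-free `P` with `P 0 = 1` is `exp (c g)` with `g 0 = 0`, and then `ψ (P, z P')` equals
`1 + 2 (1 - α) z g'`. As `halfPlaneMap α` maps the disk onto the half-plane `Re > α`, `P` solves the
differential subordination exactly when `Re (z g') > -1/2`. In that case `w = 1 - exp (-g)` maps the
disk into itself (`norm_one_sub_exp_neg_lt_one`): otherwise `|w|` reaches `1` for a first time at
some `z₀`, Jack's lemma (`exists_real_mul_deriv_eq_of_norm_le`) gives `z₀ w'(z₀) = k w(z₀)` with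
`k ≥ 1`, and `z g' = z w' / (1 - w)` has real part `-k / 2` there. Since `g = -log (1 - w)`, it
follows that `P = q ∘ w`. So `q` is a dominant (`isDominant_one_div_one_sub_cpow`), for every
exponent `c ≠ 0`. As `q` is itself a solution, it is subordinate to every dominant.

The condition on `c` serves only for the univalence of `q` (`injOn_one_div_one_sub_cpow`): it says
that `|Re (1 / c)| ≥ 1 / 2`, while `q x = q y` forces `log (1 - x) - log (1 - y) ∈ (2πi / c) ℤ`
within the strip of differences with imaginary part of modulus less than `π`.

For `f` in `classA p`, the quotient `f(z) / z^p` is analytic in the disk, and `spiralExpr p θ b f` is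
the function whose real part defines the spirallike class. That the subordination forces `f` to be
zero-free off the origin is `ne_zero_of_continuousAt_logDerivQuot`: `z f' / (p f)` has a pole at
every other zero.
-/

namespace DiskSub

open Complex Metric Set Filter Topology

lemma isOpen_unitDisk : IsOpen unitDisk := isOpen_ball

lemma zero_mem_unitDisk : (0 : ℂ) ∈ unitDisk := mem_ball_self one_pos

lemma norm_lt_one_of_mem {z : ℂ} (hz : z ∈ unitDisk) : ‖z‖ < 1 := by simpa using hz

lemma differentiableAt_of_mem {g : ℂ → ℂ} (hg : DifferentiableOn ℂ g unitDisk) {z : ℂ}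
    (hz : z ∈ unitDisk) : DifferentiableAt ℂ g z :=
  hg.differentiableAt (isOpen_unitDisk.mem_nhds hz)

lemma differentiableOn_deriv {g : ℂ → ℂ} (hg : DifferentiableOn ℂ g unitDisk) :
    DifferentiableOn ℂ (deriv g) unitDisk :=
  hg.deriv isOpen_unitDisk

lemma one_sub_ne_zero {z : ℂ} (hz : z ∈ unitDisk) : 1 - z ≠ 0 := by
  intro h
  have h1 : z = 1 := (sub_eq_zero.mp h).symm
  simp [h1] at hz

lemma one_sub_mem_slitPlane {z : ℂ} (hz : z ∈ unitDisk) : 1 - z ∈ slitPlane := by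
  refine Or.inl ?_
  have := (re_le_norm z).trans_lt (norm_lt_one_of_mem hz)
  simpa using this

/-! ### Jack's lemma -/

/-- Jack's lemma: where `|w|` attains its maximum over `|z| ≤ |z₀|`, the logarithmic derivative
`z w'(z) / w(z)` is real and at least `1`. -/
lemma exists_real_mul_deriv_eq_of_norm_le {w : ℂ → ℂ} (hw : DifferentiableOn ℂ w unitDisk)
    (hw0 : w 0 = 0) {z₀ : ℂ} (hz₀ : z₀ ∈ unitDisk) (hne : w z₀ ≠ 0)
    (hmax : ∀ z, ‖z‖ ≤ ‖z₀‖ → ‖w z‖ ≤ ‖w z₀‖) :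
    ∃ k : ℝ, 1 ≤ k ∧ z₀ * deriv w z₀ = k * w z₀ := by
  have hz0 : z₀ ≠ 0 := by rintro rfl; exact hne hw0
  have hd : HasDerivAt (fun ζ : ℂ => w (ζ * z₀) / w z₀) (z₀ * deriv w z₀ / w z₀) 1 := by
    have h1 : HasDerivAt w (deriv w z₀) (1 * z₀) := by
      simpa using (differentiableAt_of_mem hw hz₀).hasDerivAt
    have h2 : HasDerivAt (fun ζ : ℂ => ζ * z₀) z₀ 1 := by
      simpa using (hasDerivAt_id (1 : ℂ)).mul_const z₀
    have h3 := (h1.comp (1 : ℂ) h2).div_const (w z₀)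
    simpa [Function.comp_def, mul_comm] using h3
  set d : ℂ := z₀ * deriv w z₀ / w z₀ with hd_def
  -- The maximality on the circle makes the derivative of the real part in the direction `i` vanish.
  have him : d.im = 0 := by
    have hc : HasDerivAt (fun s : ℝ => exp (s * I)) I 0 := by
      have h := ((hasDerivAt_exp (((0 : ℝ) : ℂ) * I)).comp_of_eq (0 : ℝ)
        ((hasDerivAt_id (0 : ℝ)).ofReal_comp.mul_const I) rfl)
      simpa [Function.comp_def] using h
    have h1 : HasDerivAt (fun s : ℝ => w (exp (s * I) * z₀) / w z₀) (d * I) 0 := by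
      have := HasDerivAt.comp_of_eq (0 : ℝ) hd hc (by simp)
      simpa [Function.comp_def] using this
    have h2 : HasDerivAt (fun s : ℝ => (w (exp (s * I) * z₀) / w z₀).re) (d * I).re 0 := by
      have := (reCLM.hasFDerivAt (x := w (exp ((0 : ℝ) * I) * z₀) / w z₀)).comp_hasDerivAt
        (0 : ℝ) h1
      simpa [Function.comp_def] using this
    have h3 : IsLocalMax (fun s : ℝ => (w (exp (s * I) * z₀) / w z₀).re) 0 := by
      refine Eventually.of_forall fun s => ?_
      have h4 : ‖w (exp (s * I) * z₀)‖ ≤ ‖w z₀‖ := hmax _ (by simp [norm_exp_ofReal_mul_I])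
      have h5 : ‖w (exp (s * I) * z₀) / w z₀‖ ≤ 1 := by
        rw [norm_div]; exact div_le_one_of_le₀ h4 (norm_nonneg _)
      simpa [hne] using (re_le_norm _).trans h5
    simpa using h3.hasDerivAt_eq_zero h2
  -- By the Schwarz lemma, `Re (w(t z₀) / w(z₀)) ≤ t` for `0 ≤ t ≤ 1`, with equality at `t = 1`.
  have hre : 1 ≤ d.re := by
    have hS : ∀ t : ℝ, 0 ≤ t → t < 1 → (w (t * z₀) / w z₀).re ≤ t := by
      intro t ht0 ht1
      have hmaps : ∀ ζ ∈ unitDisk, ‖ζ * z₀‖ ≤ ‖z₀‖ := by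
        intro ζ hζ
        rw [norm_mul]
        exact mul_le_of_le_one_left (norm_nonneg _) (norm_lt_one_of_mem hζ).le
      have h1 : ‖w (t * z₀) / w z₀‖ ≤ ‖(t : ℂ)‖ := by
        refine norm_le_norm_of_mapsTo_ball (R := 1) (f := fun ζ => w (ζ * z₀) / w z₀)
          ?_ ?_ (by simp [hw0]) (by simpa [abs_of_nonneg ht0] using ht1)
        · refine (hw.comp (by fun_prop) fun ζ hζ => ?_).div_const _
          have := (hmaps ζ hζ).trans_lt (norm_lt_one_of_mem hz₀)
          simpa using this
        · intro ζ hζ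
          have := hmax _ (hmaps ζ hζ)
          simp only [mem_closedBall, dist_zero_right, norm_div]
          exact div_le_one_of_le₀ this (norm_nonneg _)
      refine (re_le_norm _).trans (h1.trans ?_)
      simp [abs_of_nonneg ht0]
    have h1 : HasDerivAt (fun t : ℝ => (w (t * z₀) / w z₀).re) d.re 1 := by
      have h2 : HasDerivAt (fun t : ℝ => w (t * z₀) / w z₀) d 1 := by
        have h3 := HasDerivAt.comp_of_eq (1 : ℝ) hd (hasDerivAt_id (1 : ℝ)).ofReal_comp (by simp)
        simpa [Function.comp_def] using h3
      have := (reCLM.hasFDerivAt (x := w (((1 : ℝ) : ℂ) * z₀) / w z₀)).comp_hasDerivAt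
        (1 : ℝ) h2
      simpa [Function.comp_def] using this
    have h2 := (hasDerivAt_iff_tendsto_slope.mp h1).mono_left
      (nhdsWithin_mono (1 : ℝ) (fun t (ht : t ∈ Iio (1 : ℝ)) => ne_of_lt ht))
    refine ge_of_tendsto h2 ?_
    filter_upwards [Ioo_mem_nhdsLT (zero_lt_one' ℝ)] with t ht
    have h3 := hS t ht.1.le ht.2
    rw [slope_def_field, le_div_iff_of_neg (by linarith [ht.2])]
    simp only [ofReal_one, one_mul, div_self hne, one_re]
    linarith
  refine ⟨d.re, hre, ?_⟩
  have hd' : d = (d.re : ℂ) := Complex.ext rfl (by simp [him])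
  rw [← hd', hd_def, div_mul_cancel₀ _ hne]

/-! ### Half-planes and Möbius maps -/

lemma re_div_one_sub_add_half {z : ℂ} (hz : 1 - z ≠ 0) :
    (z / (1 - z)).re + 1 / 2 = (1 - ‖z‖ ^ 2) / (2 * normSq (1 - z)) := by
  have hn : normSq (1 - z) ≠ 0 := by simpa [normSq_eq_zero] using hz
  rw [← normSq_eq_norm_sq, div_re]
  field_simp
  simp only [normSq_apply, sub_re, sub_im, one_re, one_im]
  ring

lemma neg_half_lt_re_div_one_sub {z : ℂ} (hz : z ∈ unitDisk) : -(1 / 2) < (z / (1 - z)).re := by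
  have h := re_div_one_sub_add_half (one_sub_ne_zero hz)
  have h1 : 0 < normSq (1 - z) := normSq_pos.mpr (one_sub_ne_zero hz)
  have h2 : ‖z‖ < 1 := norm_lt_one_of_mem hz
  have h3 : 0 < (1 - ‖z‖ ^ 2) / (2 * normSq (1 - z)) :=
    div_pos (by nlinarith [norm_nonneg z]) (by positivity)
  linarith

lemma halfPlaneMap_eq (α : ℝ) {z : ℂ} (hz : z ∈ unitDisk) :
    halfPlaneMap α z = 1 + 2 * (1 - (α : ℂ)) * (z / (1 - z)) := by
  have := one_sub_ne_zero hz
  unfold halfPlaneMap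
  field_simp
  ring

lemma lt_re_one_add_iff {α : ℝ} (hα : α < 1) (u : ℂ) :
    α < (1 + 2 * (1 - (α : ℂ)) * u).re ↔ -(1 / 2) < u.re := by
  have : (1 + 2 * (1 - (α : ℂ)) * u).re = 1 + 2 * (1 - α) * u.re := by simp
  rw [this]
  constructor <;> intro h <;> nlinarith

lemma differentiableOn_halfPlaneMap (α : ℝ) : DifferentiableOn ℂ (halfPlaneMap α) unitDisk := by
  unfold halfPlaneMap
  exact DifferentiableOn.div (by fun_prop) (by fun_prop) fun z hz => one_sub_ne_zero hz

lemma Subordinate.lt_re {α : ℝ} (hα : α < 1) {g : ℂ → ℂ} (h : Subordinate g (halfPlaneMap α))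
    {z : ℂ} (hz : z ∈ unitDisk) : α < (g z).re := by
  obtain ⟨-, -, ω, -, hm, -, he⟩ := h
  rw [he z hz, halfPlaneMap_eq α (hm hz), lt_re_one_add_iff hα]
  exact neg_half_lt_re_div_one_sub (hm hz)

/-- The self-map is `(g - 1) / (g + 1 - 2α)`, the inverse Möbius map applied to `g`. -/
lemma subordinate_halfPlaneMap {α : ℝ} (hα : α < 1) {g : ℂ → ℂ}
    (hg : DifferentiableOn ℂ g unitDisk) (hg0 : g 0 = 1) (h : ∀ z ∈ unitDisk, α < (g z).re) :
    Subordinate g (halfPlaneMap α) := by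
  have hden : ∀ z ∈ unitDisk, g z + 1 - 2 * (α : ℂ) ≠ 0 := by
    intro z hz h0
    have := congrArg re h0
    simp at this
    linarith [h z hz]
  refine ⟨hg, differentiableOn_halfPlaneMap α, fun z => (g z - 1) / (g z + 1 - 2 * (α : ℂ)),
    ?_, ?_, by simp [hg0], ?_⟩
  · exact DifferentiableOn.div (hg.sub_const _) ((hg.add_const _).sub_const _) hden
  · intro z hz
    have hd := hden z hz
    simp only [mem_ball, dist_zero_right, norm_div]
    rw [div_lt_one (norm_pos_iff.mpr hd)]
    refine lt_of_pow_lt_pow_left₀ 2 (norm_nonneg _) ?_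
    rw [← normSq_eq_norm_sq, ← normSq_eq_norm_sq]
    simp [normSq_apply]
    nlinarith [h z hz]
  · intro z hz
    have hd := hden z hz
    have h1 : (1 : ℂ) - (g z - 1) / (g z + 1 - 2 * (α : ℂ)) ≠ 0 := by
      rw [one_sub_div hd]
      refine div_ne_zero ?_ hd
      have : (1 : ℂ) - α ≠ 0 := by
        have : ((1 - α : ℝ) : ℂ) ≠ 0 := ofReal_ne_zero.mpr (by linarith)
        simpa using this
      intro h2
      exact this (by linear_combination h2 / 2)
    unfold halfPlaneMap
    rw [eq_div_iff h1]
    field_simp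
    ring

/-! ### Subordination to the logarithm -/

/-- If `Re (z g'(z)) > -1/2`, that is `z g' ≺ z / (1 - z)`, then `1 - exp (-g)` maps the unit disk
into itself: at a point of least modulus where it had modulus `1`, Jack's lemma would give
`z g' = k w / (1 - w)` with `|w| = 1` and `k ≥ 1`, which has real part `-k / 2`. -/
lemma norm_one_sub_exp_neg_lt_one {g : ℂ → ℂ} (hg : DifferentiableOn ℂ g unitDisk)
    (hg0 : g 0 = 0) (h : ∀ z ∈ unitDisk, -(1 / 2) < (z * deriv g z).re) {z : ℂ}
    (hz : z ∈ unitDisk) : ‖1 - exp (-g z)‖ < 1 := by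
  by_contra! hge
  set w : ℂ → ℂ := fun z => 1 - exp (-g z) with hw_def
  have hw : DifferentiableOn ℂ w unitDisk := hg.neg.cexp.const_sub 1
  have hw0 : w 0 = 0 := by simp [hw_def, hg0]
  have hsub : closedBall (0 : ℂ) ‖z‖ ⊆ unitDisk := closedBall_subset_ball (norm_lt_one_of_mem hz)
  -- a point of least modulus in the compact set of points of `|ζ| ≤ |z|` where `1 ≤ |w ζ|`
  have hK : IsCompact (closedBall (0 : ℂ) ‖z‖ ∩ {ζ | 1 ≤ ‖w ζ‖}) := by
    have hc : ContinuousOn (fun ζ => ‖w ζ‖) (closedBall (0 : ℂ) ‖z‖) :=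
      (hw.continuousOn.mono hsub).norm
    exact (isCompact_closedBall _ _).of_isClosed_subset
      (hc.preimage_isClosed_of_isClosed isClosed_closedBall isClosed_Ici) inter_subset_left
  obtain ⟨z₀, ⟨hz₀, hz₀'⟩, hmin⟩ := hK.exists_isMinOn ⟨z, by simp, hge⟩
    continuous_norm.continuousOn
  have hz₀U := hsub hz₀
  have hlt : ∀ ζ, ‖ζ‖ < ‖z₀‖ → ‖w ζ‖ < 1 := by
    intro ζ hζ
    by_contra! h1
    exact absurd (hmin (a := ζ) ⟨by simpa using hζ.le.trans (by simpa using hz₀), h1⟩)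
      (not_le.mpr hζ)
  have hz₀0 : z₀ ≠ 0 := by
    rintro rfl
    simp [hw0] at hz₀'
    linarith
  have hle : ∀ ζ, ‖ζ‖ ≤ ‖z₀‖ → ‖w ζ‖ ≤ 1 := by
    intro ζ hζ
    have hζc : ζ ∈ closure (ball (0 : ℂ) ‖z₀‖) := by
      rw [closure_ball _ (by simpa using hz₀0)]; simpa using hζ
    have hζU : ζ ∈ unitDisk := hsub (by simpa using hζ.trans (by simpa using hz₀))
    have hcont : ContinuousAt (fun ζ => ‖w ζ‖) ζ :=
      (differentiableAt_of_mem hw hζU).continuousAt.norm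
    have := mem_closure_iff_nhdsWithin_neBot.mp hζc
    refine le_of_tendsto (x := 𝓝[ball 0 ‖z₀‖] ζ) (hcont.tendsto.mono_left nhdsWithin_le_nhds)
      (eventually_nhdsWithin_of_forall fun x hx => ?_)
    exact (hlt x (mem_ball_zero_iff.mp hx)).le
  have hone : ‖w z₀‖ = 1 := le_antisymm (hle z₀ le_rfl) hz₀'
  obtain ⟨k, hk, hkeq⟩ := exists_real_mul_deriv_eq_of_norm_le hw hw0 hz₀U
    (by rw [← norm_ne_zero_iff, hone]; exact one_ne_zero) (fun ζ hζ => (hle ζ hζ).trans hone.ge)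
  have hwne : 1 - w z₀ ≠ 0 := by simp [hw_def, exp_ne_zero]
  have hder : deriv w z₀ = (1 - w z₀) * deriv g z₀ := by
    have h1 := ((differentiableAt_of_mem hg hz₀U).hasDerivAt.neg.cexp.const_sub 1).deriv
    simpa [hw_def] using h1
  have hzg : z₀ * deriv g z₀ = k * (w z₀ / (1 - w z₀)) := by
    rw [hder] at hkeq
    field_simp
    linear_combination hkeq
  have h2 := re_div_one_sub_add_half hwne
  have h3 := h z₀ hz₀U
  rw [hzg, re_ofReal_mul] at h3
  rw [hone] at h2
  norm_num at h2
  nlinarith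

/-- The logarithm of `exp (-g)` along the disk is `-g`, since `exp (-g)` stays in the right
half-plane. -/
lemma log_exp_neg_eq {g : ℂ → ℂ} (hg : DifferentiableOn ℂ g unitDisk) (hg0 : g 0 = 0)
    (h : ∀ z ∈ unitDisk, ‖1 - exp (-g z)‖ < 1) {z : ℂ} (hz : z ∈ unitDisk) :
    log (exp (-g z)) = -g z := by
  have hs : ∀ z ∈ unitDisk, exp (-g z) ∈ slitPlane := by
    intro z hz
    have := one_sub_mem_slitPlane (z := 1 - exp (-g z)) (by simpa using h z hz)
    simpa using this
  have hgd : ∀ z ∈ unitDisk, HasDerivAt (fun z => -g z) (-deriv g z) z := fun z hz =>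
    (differentiableAt_of_mem hg hz).hasDerivAt.neg
  have hl : ∀ z ∈ unitDisk, HasDerivAt (fun z => log (exp (-g z))) (-deriv g z) z := by
    intro z hz
    have := (hgd z hz).cexp.clog (hs z hz)
    rwa [mul_div_cancel_left₀ _ (exp_ne_zero _)] at this
  refine isOpen_unitDisk.eqOn_of_deriv_eq (convex_ball _ _).isPreconnected
    (f := fun z => log (exp (-g z))) (g := fun z => -g z)
    (fun z hz => (hl z hz).differentiableAt.differentiableWithinAt) hg.neg ?_
    zero_mem_unitDisk (by simp [hg0]) hz
  intro z hz
  exact (hl z hz).deriv.trans (hgd z hz).deriv.symm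

/-! ### Analytic logarithms -/

/-- A zero-free analytic function on the disk with value `1` at `0` is `exp (c g)` for an analytic
`g` with `g 0 = 0`. -/
lemma exists_eq_exp_mul {P : ℂ → ℂ} (hP : DifferentiableOn ℂ P unitDisk) (hP0 : P 0 = 1)
    (hne : ∀ z ∈ unitDisk, P z ≠ 0) {c : ℂ} (hc : c ≠ 0) :
    ∃ g : ℂ → ℂ, DifferentiableOn ℂ g unitDisk ∧ g 0 = 0 ∧ ∀ z ∈ unitDisk, P z = exp (c * g z) := by
  have hq : DifferentiableOn ℂ (fun z => deriv P z / (c * P z)) unitDisk :=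
    (differentiableOn_deriv hP).div (hP.const_mul c) fun z hz => mul_ne_zero hc (hne z hz)
  obtain ⟨g, hg0, hg⟩ := hq.isExactOn_ball.with_val_at 0 0
  have hgd : DifferentiableOn ℂ g unitDisk := fun z hz =>
    (hg z hz).differentiableAt.differentiableWithinAt
  refine ⟨g, hgd, hg0, fun z hz => ?_⟩
  have hD : ∀ z ∈ unitDisk, HasDerivAt (fun z => P z * exp (-(c * g z))) 0 z := by
    intro z hz
    have h1 := (differentiableAt_of_mem hP hz).hasDerivAt.mul ((hg z hz).const_mul c).neg.cexp
    refine h1.congr_deriv ?_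
    have := hne z hz
    change deriv P z * exp (-(c * g z)) +
      P z * (exp (-(c * g z)) * -(c * (deriv P z / (c * P z)))) = 0
    field_simp
    ring
  have h2 := isOpen_unitDisk.eqOn_of_deriv_eq (convex_ball _ _).isPreconnected
    (f := fun z => P z * exp (-(c * g z))) (g := fun _ => 1)
    (fun z hz => (hD z hz).differentiableAt.differentiableWithinAt) (differentiableOn_const _)
    (fun z hz => by simp [(hD z hz).deriv]) zero_mem_unitDisk (by simp [hP0, hg0]) hz
  simp only [exp_neg] at h2
  exact (mul_inv_eq_one₀ (exp_ne_zero _)).mp h2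

/-! ### The power of `1 - z` -/

lemma one_div_one_sub_cpow_eq_exp (c : ℂ) {z : ℂ} (hz : z ∈ unitDisk) :
    1 / (1 - z) ^ c = exp (-(c * log (1 - z))) := by
  rw [cpow_def_of_ne_zero (one_sub_ne_zero hz), one_div, ← exp_neg, mul_comm]

lemma hasDerivAt_one_div_one_sub_cpow (c : ℂ) {z : ℂ} (hz : z ∈ unitDisk) :
    HasDerivAt (fun z => 1 / (1 - z) ^ c) (c / (1 - z) * (1 / (1 - z) ^ c)) z := by
  have h1 : HasDerivAt (fun z : ℂ => log (1 - z)) (-1 / (1 - z)) z :=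
    ((hasDerivAt_id z).const_sub 1).clog (one_sub_mem_slitPlane hz)
  have h2 : HasDerivAt (fun z : ℂ => -(c * log (1 - z))) (-(c * (-1 / (1 - z)))) z :=
    (h1.const_mul c).neg
  rw [one_div_one_sub_cpow_eq_exp c hz]
  refine (h2.cexp.congr_deriv (by ring)).congr_of_eventuallyEq ?_
  filter_upwards [isOpen_unitDisk.mem_nhds hz] with x hx
  exact one_div_one_sub_cpow_eq_exp c hx

lemma differentiableOn_one_div_one_sub_cpow (c : ℂ) :
    DifferentiableOn ℂ (fun z : ℂ => 1 / (1 - z) ^ c) unitDisk := fun _ hz =>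
  (hasDerivAt_one_div_one_sub_cpow c hz).differentiableAt.differentiableWithinAt

/-- Either disk condition on `c` puts `1 / c` outside the strip `|Re| < 1 / 2`. -/
lemma one_le_two_mul_abs_re_inv {c : ℂ} (hc : c ≠ 0) (h : ‖c + 1‖ ≤ 1 ∨ ‖c - 1‖ ≤ 1) :
    1 ≤ 2 * |(c⁻¹).re| := by
  have hn : 0 < normSq c := normSq_pos.mpr hc
  have key : normSq c ≤ 2 * |c.re| := by
    rcases h with h | h
    · have h1 : normSq (c + 1) ≤ 1 := by
        rw [normSq_eq_norm_sq]; exact pow_le_one₀ (norm_nonneg _) h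
      simp only [normSq_apply, add_re, add_im, one_re, one_im] at h1 ⊢
      nlinarith [neg_abs_le c.re]
    · have h1 : normSq (c - 1) ≤ 1 := by
        rw [normSq_eq_norm_sq]; exact pow_le_one₀ (norm_nonneg _) h
      simp only [normSq_apply, sub_re, sub_im, one_re, one_im] at h1 ⊢
      nlinarith [le_abs_self c.re]
  rw [inv_re, abs_div, abs_of_pos hn, ← mul_div_assoc, le_div_iff₀ hn]
  linarith

/-- If two values of `(1 - z) ^ (-c)` agree, then the logarithms of `1 - z` differ by an integer
multiple of `2πi / c`. Unless the multiple is zero, its imaginary part has modulus at least `π`,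
whereas `log (1 - z)` lies in the strip `|Im| < π / 2`. -/
lemma injOn_one_div_one_sub_cpow {c : ℂ} (hc : c ≠ 0) (h : ‖c + 1‖ ≤ 1 ∨ ‖c - 1‖ ≤ 1) :
    InjOn (fun z : ℂ => 1 / (1 - z) ^ c) unitDisk := by
  intro x hx y hy hxy
  simp only [one_div_one_sub_cpow_eq_exp c hx, one_div_one_sub_cpow_eq_exp c hy] at hxy
  obtain ⟨n, hn⟩ := exp_eq_exp_iff_exists_int.mp hxy
  have him : ∀ z ∈ unitDisk, |(log (1 - z)).im| < Real.pi / 2 := by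
    intro z hz
    rw [log_im, abs_arg_lt_pi_div_two_iff]
    have := (re_le_norm z).trans_lt (norm_lt_one_of_mem hz)
    exact Or.inl (by simpa using this)
  have hdiff : log (1 - y) - log (1 - x) = ((n * (2 * Real.pi) : ℝ) : ℂ) * I * c⁻¹ := by
    field_simp
    push_cast
    linear_combination hn
  have hn0 : n = 0 := by
    by_contra hn0
    have h1 : (log (1 - y) - log (1 - x)).im = n * (2 * Real.pi) * (c⁻¹).re := by
      rw [hdiff, mul_assoc, im_ofReal_mul, I_mul_im]
    have h2 : |(log (1 - y) - log (1 - x)).im| < Real.pi := by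
      rw [sub_im]
      have := abs_sub (log (1 - y)).im (log (1 - x)).im
      linarith [him x hx, him y hy]
    have h3 : (1 : ℝ) ≤ |(n : ℝ)| := by exact_mod_cast Int.one_le_abs hn0
    rw [h1, abs_mul, abs_mul, abs_of_pos Real.two_pi_pos] at h2
    have h4 := one_le_two_mul_abs_re_inv hc h
    have h5 : 1 * 1 ≤ |(n : ℝ)| * (2 * |(c⁻¹).re|) := mul_le_mul h3 h4 zero_le_one (abs_nonneg _)
    nlinarith [Real.pi_pos]
  have hlog : log (1 - y) = log (1 - x) := by
    simpa [hn0, sub_eq_zero] using hdiff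
  have h6 := congrArg exp hlog
  rw [exp_log (one_sub_ne_zero hx), exp_log (one_sub_ne_zero hy)] at h6
  linear_combination h6

/-! ### The differential subordination -/

lemma cos_ofReal_ne_zero {θ : ℝ} (hθ : |θ| < Real.pi / 2) : ((Real.cos θ : ℝ) : ℂ) ≠ 0 := by
  have h := abs_lt.mp hθ
  exact ofReal_ne_zero.mpr (Real.cos_pos_of_mem_Ioo ⟨by linarith, h.2⟩).ne'

lemma spiralExponent_ne_zero {p : ℕ} (hp : 1 ≤ p) {θ α : ℝ} (hθ : |θ| < Real.pi / 2)
    (hα : α < 1) {a b : ℂ} (ha : a ≠ 0) (hb : b ≠ 0) : spiralExponent p θ α a b ≠ 0 := by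
  have hp' : (p : ℂ) ≠ 0 := by exact_mod_cast (by lia : p ≠ 0)
  have hα' : (1 : ℂ) - α ≠ 0 := by
    have : ((1 - α : ℝ) : ℂ) ≠ 0 := ofReal_ne_zero.mpr (by linarith)
    simpa using this
  have := cos_ofReal_ne_zero hθ
  have := exp_ne_zero (-(I * θ))
  unfold spiralExponent
  simp_all

/-- With `z P'(z) / P(z)` written as `c u`, where `c` is the exponent of the dominant, the operator
`ψ` depends on `u` and `α` alone. -/
lemma spiralPsi_mul_eq {p : ℕ} (hp : 1 ≤ p) {θ : ℝ} (α : ℝ) (hθ : |θ| < Real.pi / 2)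
    {a b : ℂ} (ha : a ≠ 0) (hb : b ≠ 0) {r : ℂ} (hr : r ≠ 0) (u z : ℂ) :
    spiralPsi p θ a b r (spiralExponent p θ α a b * u * r) z = 1 + 2 * (1 - (α : ℂ)) * u := by
  have hp' : (p : ℂ) ≠ 0 := by exact_mod_cast (by lia : p ≠ 0)
  have hcos := cos_ofReal_ne_zero hθ
  have hexp := exp_ne_zero (I * θ)
  unfold spiralPsi spiralExponent
  rw [exp_neg]
  field_simp

/-- Writing a solution as `exp (c g)` turns the differential subordination into
`Re (z g') > -1/2`. -/
lemma isDominant_one_div_one_sub_cpow {p : ℕ} (hp : 1 ≤ p) {θ α : ℝ} (hθ : |θ| < Real.pi / 2)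
    (hα : α < 1) {a b : ℂ} (ha : a ≠ 0) (hb : b ≠ 0) :
    IsDominant {0}ᶜ 1 (spiralPsi p θ a b) (halfPlaneMap α)
      (fun z => 1 / (1 - z) ^ spiralExponent p θ α a b) := by
  have hc := spiralExponent_ne_zero hp hθ hα ha hb
  refine ⟨differentiableOn_one_div_one_sub_cpow _, ?_⟩
  rintro P ⟨hP, hP0, hPm, hsub⟩
  have hne : ∀ z ∈ unitDisk, P z ≠ 0 := fun z hz => hPm hz
  obtain ⟨g, hg, hg0, hPg⟩ := exists_eq_exp_mul hP hP0 hne hc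
  have hre : ∀ z ∈ unitDisk, -(1 / 2) < (z * deriv g z).re := by
    intro z hz
    have hder : deriv P z = spiralExponent p θ α a b * deriv g z * P z := by
      have h1 := ((differentiableAt_of_mem hg hz).hasDerivAt.const_mul
        (spiralExponent p θ α a b)).cexp
      have h2 : P =ᶠ[𝓝 z] fun z => exp (spiralExponent p θ α a b * g z) := by
        filter_upwards [isOpen_unitDisk.mem_nhds hz] with x hx using hPg x hx
      rw [h2.deriv_eq, h1.deriv, hPg z hz]
      ring
    have h1 := hsub.lt_re hα hz
    have h2 : z * deriv P z = spiralExponent p θ α a b * (z * deriv g z) * P z := by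
      rw [hder]; ring
    simp only [h2] at h1
    rwa [spiralPsi_mul_eq hp α hθ ha hb (hne z hz), lt_re_one_add_iff hα] at h1
  have hlt : ∀ z ∈ unitDisk, ‖1 - exp (-g z)‖ < 1 := fun z hz =>
    norm_one_sub_exp_neg_lt_one hg hg0 hre hz
  refine ⟨hP, differentiableOn_one_div_one_sub_cpow _, fun z => 1 - exp (-g z),
    hg.neg.cexp.const_sub 1, fun z hz => by simpa using hlt z hz, by simp [hg0], fun z hz => ?_⟩
  have hmem : 1 - exp (-g z) ∈ unitDisk := by simpa using hlt z hz
  beta_reduce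
  rw [one_div_one_sub_cpow_eq_exp _ hmem, sub_sub_cancel, log_exp_neg_eq hg hg0 hlt hz,
    hPg z hz, mul_neg, neg_neg]

lemma isSolution_one_div_one_sub_cpow {p : ℕ} (hp : 1 ≤ p) {θ α : ℝ} (hθ : |θ| < Real.pi / 2)
    {a b : ℂ} (ha : a ≠ 0) (hb : b ≠ 0) :
    IsSolution {0}ᶜ 1 (spiralPsi p θ a b) (halfPlaneMap α)
      (fun z => 1 / (1 - z) ^ spiralExponent p θ α a b) := by
  have hne : ∀ z ∈ unitDisk, 1 / (1 - z) ^ spiralExponent p θ α a b ≠ 0 := by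
    intro z hz
    rw [one_div_one_sub_cpow_eq_exp _ hz]
    exact exp_ne_zero _
  have heq : ∀ z ∈ unitDisk, spiralPsi p θ a b (1 / (1 - z) ^ spiralExponent p θ α a b)
      (z * deriv (fun z => 1 / (1 - z) ^ spiralExponent p θ α a b) z) z = halfPlaneMap α z := by
    intro z hz
    rw [(hasDerivAt_one_div_one_sub_cpow _ hz).deriv, halfPlaneMap_eq α hz,
      ← spiralPsi_mul_eq hp α hθ ha hb (hne z hz) (z / (1 - z)) z]
    congr 1
    ring
  exact ⟨differentiableOn_one_div_one_sub_cpow _, by simp, hne,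
    (differentiableOn_halfPlaneMap α).congr heq, differentiableOn_halfPlaneMap α, id,
    differentiableOn_id, mapsTo_id _, rfl, heq⟩

/-! ### The classes of multivalent functions -/

lemma eq_pow_mul_normQuot {p : ℕ} (hp : 1 ≤ p) {f : ℂ → ℂ} (hf : f ∈ classA p) (z : ℂ) :
    f z = z ^ p * normQuot p f z := by
  obtain ⟨-, c, hc⟩ := hf
  rcases eq_or_ne z 0 with rfl | hz
  · have hp0 : p ≠ 0 := by lia
    have h := (hc 0 zero_mem_unitDisk).tsum_eq
    simpa [hp0, eq_comm] using h
  · rw [normQuot, if_neg hz]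
    field_simp

lemma differentiableOn_normQuot {p : ℕ} {f : ℂ → ℂ} (hf : f ∈ classA p) :
    DifferentiableOn ℂ (normQuot p f) unitDisk := by
  obtain ⟨hfd, c, hc⟩ := hf
  rw [← differentiableOn_compl_singleton_and_continuousAt_iff
    (isOpen_unitDisk.mem_nhds zero_mem_unitDisk)]
  constructor
  · have h1 : DifferentiableOn ℂ (fun z => f z / z ^ p) (unitDisk \ {0}) :=
      (hfd.mono sdiff_subset).div (by fun_prop) fun z hz => pow_ne_zero _ hz.2
    refine h1.congr fun z hz => ?_
    have hz0 : z ≠ 0 := hz.2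
    rw [normQuot, if_neg hz0]
  · have hsum : ∀ z ∈ unitDisk, z ≠ 0 →
        HasSum (fun k => c k * z ^ k * z) (normQuot p f z - 1) := by
      intro z hz hz0
      have h1 := (hc z hz).mul_right (z ^ p)⁻¹
      have h2 : (f z - z ^ p) * (z ^ p)⁻¹ = normQuot p f z - 1 := by
        rw [normQuot, if_neg hz0]
        field_simp
      rw [h2] at h1
      refine h1.congr_fun fun k => ?_
      rw [pow_add, pow_add]
      field_simp
    have hhalf : Summable fun k => ‖c k‖ * (1 / 2 : ℝ) ^ k := by
      have h1 := (hsum (1 / 2) (by norm_num) (by norm_num)).summable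
      have h2 := ((summable_mul_right_iff (by norm_num)).mp h1).norm
      simpa using h2
    have hb : ∀ z : ℂ, ‖z‖ < 1 / 2 →
        ‖normQuot p f z - 1‖ ≤ (∑' k, ‖c k‖ * (1 / 2 : ℝ) ^ k) * ‖z‖ := by
      intro z hz
      rcases eq_or_ne z 0 with rfl | hz0
      · simp [normQuot]
      have hz1 : z ∈ unitDisk := by
        rw [mem_ball_zero_iff]
        linarith
      rw [← (hsum z hz1 hz0).tsum_eq]
      refine tsum_of_norm_bounded (hhalf.hasSum.mul_right ‖z‖) fun k => ?_
      rw [norm_mul, norm_mul, norm_pow]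
      gcongr
    have h0 : normQuot p f 0 = 1 := by simp [normQuot]
    rw [ContinuousAt, h0, tendsto_iff_norm_sub_tendsto_zero]
    refine squeeze_zero' (Eventually.of_forall fun z => norm_nonneg _)
      (g := fun z => (∑' k, ‖c k‖ * (1 / 2 : ℝ) ^ k) * ‖z‖) ?_ ?_
    · filter_upwards [ball_mem_nhds (0 : ℂ) (by norm_num : (0 : ℝ) < 1 / 2)] with z hz
      exact hb z (mem_ball_zero_iff.mp hz)
    · have h1 : Continuous fun z : ℂ => (∑' k, ‖c k‖ * (1 / 2 : ℝ) ^ k) * ‖z‖ := by fun_prop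
      simpa using h1.tendsto 0

lemma normQuot_ne_zero {p : ℕ} {f : ℂ → ℂ} (hne : ∀ z ∈ unitDisk, z ≠ 0 → f z ≠ 0) {z : ℂ}
    (hz : z ∈ unitDisk) : normQuot p f z ≠ 0 := by
  unfold normQuot
  split_ifs with h
  · exact one_ne_zero
  · exact div_ne_zero (hne z hz h) (pow_ne_zero _ h)

lemma logDerivQuot_eq {p : ℕ} (hp : 1 ≤ p) {f : ℂ → ℂ} (hf : f ∈ classA p)
    (hne : ∀ z ∈ unitDisk, z ≠ 0 → f z ≠ 0) {z : ℂ} (hz : z ∈ unitDisk) :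
    logDerivQuot p f z = 1 + z * deriv (normQuot p f) z / (p * normQuot p f z) := by
  have hp' : (p : ℂ) ≠ 0 := by exact_mod_cast (by lia : p ≠ 0)
  rcases eq_or_ne z 0 with rfl | hz0
  · simp [logDerivQuot]
  have hF := (differentiableAt_of_mem (differentiableOn_normQuot hf) hz).hasDerivAt
  have hd : deriv f z = p * z ^ (p - 1) * normQuot p f z + z ^ p * deriv (normQuot p f) z := by
    have h1 : f = fun z => z ^ p * normQuot p f z := funext (eq_pow_mul_normQuot hp hf)
    conv_lhs => rw [h1]
    exact ((hasDerivAt_pow p z).mul hF).deriv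
  have hFne : normQuot p f z ≠ 0 := normQuot_ne_zero hne hz
  have hzp : z * z ^ (p - 1) = z ^ p := by rw [← pow_succ', Nat.sub_add_cancel hp]
  rw [logDerivQuot, if_neg hz0, hd, eq_pow_mul_normQuot hp hf z]
  have hzp0 : z ^ p ≠ 0 := pow_ne_zero _ hz0
  field_simp
  linear_combination (p : ℂ) * normQuot p f z * hzp

lemma spiralExpr_zero (p : ℕ) (θ : ℝ) (b : ℂ) (f : ℂ → ℂ) : spiralExpr p θ b f 0 = 1 := by
  simp [spiralExpr, logDerivQuot]

/-- The quotient `z f' / (p f)` has a pole at every zero of `f` other than the origin, so it has no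
continuous extension there. -/
lemma ne_zero_of_continuousAt_logDerivQuot {p : ℕ} (hp : 1 ≤ p) {f : ℂ → ℂ} (hf : f ∈ classA p)
    {z₀ : ℂ} (hz₀ : z₀ ∈ unitDisk) (hz0 : z₀ ≠ 0) (hcont : ContinuousAt (logDerivQuot p f) z₀) :
    f z₀ ≠ 0 := by
  intro hf0
  have hp' : (p : ℂ) ≠ 0 := by exact_mod_cast (by lia : p ≠ 0)
  have han : AnalyticOnNhd ℂ f unitDisk := hf.1.analyticOnNhd isOpen_unitDisk
  have hnz : ¬∀ᶠ z in 𝓝 z₀, f z = 0 := by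
    intro h
    have h1 : EqOn f 0 unitDisk := han.eqOn_zero_of_preconnected_of_eventuallyEq_zero
      (convex_ball _ _).isPreconnected hz₀ h
    have h2 : Tendsto (normQuot p f) (𝓝[≠] 0) (𝓝 1) := by
      have := (differentiableAt_of_mem (differentiableOn_normQuot hf) zero_mem_unitDisk).continuousAt
      have h0 : normQuot p f 0 = 1 := by simp [normQuot]
      rw [ContinuousAt, h0] at this
      exact this.mono_left nhdsWithin_le_nhds
    have h3 : Tendsto (normQuot p f) (𝓝[≠] 0) (𝓝 0) := by
      refine tendsto_const_nhds.congr' ?_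
      filter_upwards [self_mem_nhdsWithin,
        nhdsWithin_le_nhds (isOpen_unitDisk.mem_nhds zero_mem_unitDisk)] with z hz hzU
      have hz' : z ≠ 0 := hz
      simp [normQuot, hz', h1 hzU]
    exact one_ne_zero (tendsto_nhds_unique h2 h3)
  obtain ⟨n, g, hg, hgne, hfg⟩ :=
    (han z₀ hz₀).exists_eventuallyEq_pow_smul_nonzero_iff.mpr hnz
  have hn : n ≠ 0 := by
    rintro rfl
    have := hfg.self_of_nhds
    simp [hf0] at this
    exact hgne this.symm
  -- `(z - z₀) z f' / f` tends to `n z₀`, where `n` is the order of the zero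
  have hlim1 : Tendsto (fun z => z * (n * g z + (z - z₀) * deriv g z) / g z) (𝓝[≠] z₀)
      (𝓝 (z₀ * n)) := by
    have hc : ContinuousAt (fun z => z * (n * g z + (z - z₀) * deriv g z) / g z) z₀ := by
      have hg1 := hg.continuousAt
      have hg2 := hg.deriv.continuousAt
      exact ContinuousAt.div (by fun_prop) hg1 hgne
    have h1 : z₀ * (n * g z₀ + (z₀ - z₀) * deriv g z₀) / g z₀ = z₀ * n := by
      rw [sub_self, zero_mul, add_zero]
      field_simp
    have h2 := hc.tendsto
    rw [h1] at h2
    exact h2.mono_left nhdsWithin_le_nhds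
  have hlim2 : Tendsto (fun z => (z - z₀) * (p * logDerivQuot p f z)) (𝓝[≠] z₀) (𝓝 0) := by
    have hc : ContinuousAt (fun z => (z - z₀) * (p * logDerivQuot p f z)) z₀ := by fun_prop
    have h2 := hc.tendsto
    rw [sub_self, zero_mul] at h2
    exact h2.mono_left nhdsWithin_le_nhds
  have heq : ∀ᶠ z in 𝓝[≠] z₀, (z - z₀) * (p * logDerivQuot p f z) =
      z * (n * g z + (z - z₀) * deriv g z) / g z := by
    have hg' : ∀ᶠ z in 𝓝 z₀, AnalyticAt ℂ g z := hg.eventually_analyticAt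
    have hgn : ∀ᶠ z in 𝓝 z₀, g z ≠ 0 := hg.continuousAt.eventually_ne hgne
    have hz' : ∀ᶠ z : ℂ in 𝓝 z₀, z ≠ 0 := continuousAt_id.eventually_ne hz0
    filter_upwards [self_mem_nhdsWithin, nhdsWithin_le_nhds hg', nhdsWithin_le_nhds hgn,
      nhdsWithin_le_nhds hz', nhdsWithin_le_nhds hfg.eventually_nhds]
      with z hz hgz hgnz hznz hfz
    have hsub : z - z₀ ≠ 0 := sub_ne_zero.mpr hz
    have hd : deriv f z = n * (z - z₀) ^ (n - 1) * g z + (z - z₀) ^ n * deriv g z := by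
      have h1 : HasDerivAt (fun z => (z - z₀) ^ n) (n * (z - z₀) ^ (n - 1)) z := by
        exact (((hasDerivAt_id z).sub_const z₀).pow n).congr_deriv (by simp)
      have h2 : f =ᶠ[𝓝 z] fun z => (z - z₀) ^ n * g z := hfz
      rw [h2.deriv_eq]
      exact (h1.mul hgz.differentiableAt.hasDerivAt).deriv
    have hpow : (z - z₀) * (z - z₀) ^ (n - 1) = (z - z₀) ^ n := by
      rw [← pow_succ', Nat.sub_add_cancel (by lia)]
    have hpn : (z - z₀) ^ n ≠ 0 := pow_ne_zero _ hsub
    rw [logDerivQuot, if_neg hznz, hd, hfz.self_of_nhds, smul_eq_mul]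
    field_simp
    linear_combination (n : ℂ) * g z * hpow
  have h0 := tendsto_nhds_unique (hlim2.congr' heq) hlim1
  exact mul_ne_zero hz0 (Nat.cast_ne_zero.mpr hn) h0.symm

lemma spirallike_expr_eq_spiralExpr {p : ℕ} {θ : ℝ} (hθ : |θ| < Real.pi / 2) {b : ℂ} (hb : b ≠ 0)
    (f : ℂ → ℂ) (z : ℂ) :
    1 / (b * (Real.cos θ : ℂ)) * (exp (I * θ) * logDerivQuot p f z
      - (1 - b) * (Real.cos θ : ℂ) - I * (Real.sin θ : ℂ)) = spiralExpr p θ b f z := by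
  have hcos := cos_ofReal_ne_zero hθ
  have hexp : exp (I * θ) = (Real.cos θ : ℂ) + I * (Real.sin θ : ℂ) := by
    rw [mul_comm, exp_mul_I, ofReal_cos, ofReal_sin, mul_comm I]
  unfold spiralExpr
  field_simp
  linear_combination hexp

lemma differentiableOn_spiralExpr {p : ℕ} (hp : 1 ≤ p) (θ : ℝ) (b : ℂ) {f : ℂ → ℂ}
    (hf : f ∈ classA p) (hne : ∀ z ∈ unitDisk, z ≠ 0 → f z ≠ 0) :
    DifferentiableOn ℂ (spiralExpr p θ b f) unitDisk := by
  have hp' : (p : ℂ) ≠ 0 := by exact_mod_cast (by lia : p ≠ 0)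
  have hF := differentiableOn_normQuot hf
  have h1 : DifferentiableOn ℂ (logDerivQuot p f) unitDisk := by
    refine DifferentiableOn.congr (f := fun z =>
      1 + z * deriv (normQuot p f) z / (p * normQuot p f z)) ?_ fun z hz =>
      logDerivQuot_eq hp hf hne hz
    exact ((differentiableOn_id.mul (differentiableOn_deriv hF)).div (hF.const_mul _)
      fun z hz => mul_ne_zero hp' (normQuot_ne_zero hne hz)).const_add 1
  exact ((h1.sub_const 1).const_mul _).const_add 1

/-- That `f` has no zero in the punctured disk follows from the subordination, since its left side
is assumed analytic and would have a pole at such a zero. -/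
lemma mem_spirallike_iff_subordinate {p : ℕ} (hp : 1 ≤ p) {θ α : ℝ} (hθ : |θ| < Real.pi / 2)
    (hα : α < 1) {b : ℂ} (hb : b ≠ 0) {f : ℂ → ℂ} (hf : f ∈ classA p) :
    f ∈ spirallike p θ α b ↔ Subordinate (spiralExpr p θ b f) (halfPlaneMap α) := by
  constructor
  · rintro ⟨-, hne, hre⟩
    refine subordinate_halfPlaneMap hα (differentiableOn_spiralExpr hp θ b hf hne)
      (spiralExpr_zero p θ b f) fun z hz => ?_
    rw [← spirallike_expr_eq_spiralExpr hθ hb]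
    exact hre z hz
  · intro h
    refine ⟨hf, fun z hz hz0 => ?_, fun z hz => ?_⟩
    · refine ne_zero_of_continuousAt_logDerivQuot hp hf hz hz0 ?_
      have hcos := cos_ofReal_ne_zero hθ
      have hexp := exp_ne_zero (I * θ)
      have h1 : logDerivQuot p f = fun z =>
          1 + b * (Real.cos θ : ℂ) / exp (I * θ) * (spiralExpr p θ b f z - 1) := by
        funext z
        unfold spiralExpr
        field_simp
        ring
      have h2 := (differentiableAt_of_mem h.1 hz).continuousAt
      rw [h1]
      fun_prop
    · rw [spirallike_expr_eq_spiralExpr hθ hb]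
      exact h.lt_re hα hz

lemma exists_isPower {F : ℂ → ℂ} (hF : DifferentiableOn ℂ F unitDisk) (hF0 : F 0 = 1)
    (hne : ∀ z ∈ unitDisk, F z ≠ 0) (a : ℂ) : ∃ G : ℂ → ℂ, IsPower F a G := by
  obtain ⟨g, hg, hg0, hFg⟩ := exists_eq_exp_mul hF hF0 hne one_ne_zero
  exact ⟨fun z => exp (a * g z), g, hg, hg0, fun z hz => by rw [hFg z hz, one_mul],
    fun z _ => rfl⟩

/-- On `(f(z) / z^p)^a` the operator `ψ` takes the values of `spiralExpr`, so the differential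
subordination is the one that characterizes the class of `f`. -/
lemma isSolution_of_isPower {p : ℕ} (hp : 1 ≤ p) {θ α : ℝ} (hθ : |θ| < Real.pi / 2)
    (hα : α < 1) {a b : ℂ} (ha : a ≠ 0) (hb : b ≠ 0) {f : ℂ → ℂ}
    (hf : f ∈ spirallike p θ α b) {G : ℂ → ℂ} (hG : IsPower (normQuot p f) a G) :
    IsSolution {0}ᶜ 1 (spiralPsi p θ a b) (halfPlaneMap α) G := by
  obtain ⟨L, hL, hL0, hexpL, hGL⟩ := hG
  have hp' : (p : ℂ) ≠ 0 := by exact_mod_cast (by lia : p ≠ 0)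
  have hsub := (mem_spirallike_iff_subordinate hp hθ hα hb hf.1).mp hf
  have hLd : ∀ z ∈ unitDisk, deriv (normQuot p f) z = normQuot p f z * deriv L z := by
    intro z hz
    have h2 : normQuot p f =ᶠ[𝓝 z] fun z => exp (L z) := by
      filter_upwards [isOpen_unitDisk.mem_nhds hz] with x hx using (hexpL x hx).symm
    rw [h2.deriv_eq, (differentiableAt_of_mem hL hz).hasDerivAt.cexp.deriv, hexpL z hz]
  have hGd : ∀ z ∈ unitDisk, deriv G z = G z * (a * deriv L z) := by
    intro z hz
    have h2 : G =ᶠ[𝓝 z] fun z => exp (a * L z) := by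
      filter_upwards [isOpen_unitDisk.mem_nhds hz] with x hx using hGL x hx
    rw [h2.deriv_eq, ((differentiableAt_of_mem hL hz).hasDerivAt.const_mul a).cexp.deriv, hGL z hz]
  have hGne : ∀ z ∈ unitDisk, G z ≠ 0 := fun z hz => by rw [hGL z hz]; exact exp_ne_zero _
  have heq : ∀ z ∈ unitDisk,
      spiralPsi p θ a b (G z) (z * deriv G z) z = spiralExpr p θ b f z := by
    intro z hz
    have hFne : normQuot p f z ≠ 0 := normQuot_ne_zero hf.2.1 hz
    have hGnz := hGne z hz
    have hcos := cos_ofReal_ne_zero hθ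
    rw [spiralPsi, spiralExpr, logDerivQuot_eq hp hf.1 hf.2.1 hz, hGd z hz, hLd z hz]
    field_simp
    ring
  refine ⟨(hL.const_mul a).cexp.congr hGL, ?_, hGne, hsub.1.congr heq, hsub.2.1, ?_⟩
  · rw [hGL 0 zero_mem_unitDisk, hL0, mul_zero, exp_zero]
  · obtain ⟨-, -, ω, hω, hm, h0, he⟩ := hsub
    exact ⟨ω, hω, hm, h0, fun z hz => (heq z hz).trans (he z hz)⟩

end DiskSub

theorem mainTheorem5 (p : ℕ) (hp : 1 ≤ p) (θ α : ℝ) (hθ : |θ| < Real.pi / 2)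
    (hα0 : 0 ≤ α) (hα1 : α < 1) (a b : ℂ) (ha : a ≠ 0) (hb : b ≠ 0)
    (hB : ‖DiskSub.spiralExponent p θ α a b + 1‖ ≤ 1 ∨
      ‖DiskSub.spiralExponent p θ α a b - 1‖ ≤ 1) :
    (∀ f ∈ DiskSub.classA p,
      (f ∈ DiskSub.spirallike p θ α b ↔
        DiskSub.Subordinate (DiskSub.spiralExpr p θ b f) (DiskSub.halfPlaneMap α))) ∧
    (∀ f ∈ DiskSub.spirallike p θ α b,
      (∃ G : ℂ → ℂ, DiskSub.IsPower (DiskSub.normQuot p f) a G) ∧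
      ∀ G : ℂ → ℂ, DiskSub.IsPower (DiskSub.normQuot p f) a G →
        DiskSub.IsSolution {0}ᶜ 1 (DiskSub.spiralPsi p θ a b) (DiskSub.halfPlaneMap α) G ∧
        DiskSub.Subordinate G
          (fun z => 1 / (1 - z) ^ DiskSub.spiralExponent p θ α a b)) ∧
    DiskSub.IsBestDominant {0}ᶜ 1 (DiskSub.spiralPsi p θ a b) (DiskSub.halfPlaneMap α)
      (fun z => 1 / (1 - z) ^ DiskSub.spiralExponent p θ α a b) := by
  have hdom := DiskSub.isDominant_one_div_one_sub_cpow hp hθ hα1 ha hb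
  refine ⟨fun f hf => DiskSub.mem_spirallike_iff_subordinate hp hθ hα1 hb hf,
    fun f hf => ⟨?_, fun G hG => ?_⟩, hdom, ?_, fun r hr => ?_⟩
  · exact DiskSub.exists_isPower (DiskSub.differentiableOn_normQuot hf.1)
      (by simp [DiskSub.normQuot]) (fun z hz => DiskSub.normQuot_ne_zero hf.2.1 hz) a
  · have hsol := DiskSub.isSolution_of_isPower hp hθ hα1 ha hb hf hG
    exact ⟨hsol, hdom.2 G hsol⟩
  · exact DiskSub.injOn_one_div_one_sub_cpow
      (DiskSub.spiralExponent_ne_zero hp hθ hα1 ha hb) hB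
  · exact hr.2 _ (DiskSub.isSolution_one_div_one_sub_cpow hp hθ ha hb)
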